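/- All simplicial complexes are finite and abstract, and $\emptyset$ counts as a face. A simplicial complex is called a *polytopal sphere* if it is isomorphic to the boundary complex of a simplicial polytope, that is, to the complex whose faces are the vertex sets of the proper faces of a convex polytope $P\subset\mathbb{R}^n$ all of whose proper faces are simplices. For a vertex $v$ of a simplicial complex $S$ put $\operatorname{star}_S(v)=\{F\in S: v\in F\}$ and $\operatorname{link}_S(v)=\{F\in S: v\notin F,\ F\cup\{v\}\in S\}$. The *one-point suspension* of $S$ with respect to $v$ is $$\operatorname{Susp}_1(v,S)=\bigl((\partial\,\overline{v'v''}*S)\setminus(\partial\,\overline{v'v''}*\operatorname{star}_S(v))\bigr)\cup\bigl(\overline{v'v''}*\operatorname{link}_S(v)\bigr),$$ where $*$ denotes the join, $v',v''$ are two new vertices not in $S$, $\overline{v'v''}=\{\emptyset,\{v'\},\{v''\},\{v',v''\}\}$ is the edge they span and $\partial\,\overline{v'v''}=\{\emptyset,\{v'\},\{v''\}\}$. For an integer $d\ge 0$, the *wreath product* $\partial\Delta_d\wr S$ is the simplicial complex on $d+1$ copies $v^1,\dots,v^{d+1}$ of each vertex $v$ of $S$ whose facets are the sets $$\bigcup_{v\in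 F}\{v^1,\dots,v^{d+1}\}\ \cup\bigcup_{v\notin F}\bigl(\{v^1,\dots,v^{d+1}\}\setminus\{v^{c(v)}\}\bigr),$$ where $F$ is a facet of $S$ and exactly one copy $v^{c(v)}$, $c(v)\in\{1,\dots,d+1\}$, is omitted for each vertex $v\notin F$ of $S$. **Proposition.** Let $S$ be a finite simplicial complex. 1. For every vertex $v$ of $S$, the one-point suspension $\operatorname{Susp}_1(v,S)$ is a polytopal sphere if and only if $S$ is a polytopal sphere. 2. For every integer $d\ge 0$, the wreath product $\partial\Delta_d\wr S$ is a polytopal sphere if and only if $S$ is a polytopal sphere. -/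

import Mathlib

namespace PolytopalSpheres

/-- The vertices of a simplicial complex. -/
def vertices {ι : Type*} (K : PreAbstractSimplicialComplex ι) : Set ι :=
  {v | {v} ∈ K.faces}

/-- All faces of a simplicial complex, the empty face included. -/
def allFaces {ι : Type*} (K : PreAbstractSimplicialComplex ι) : Set (Finset ι) :=
  insert ∅ K.faces

/-- The (open) star of `v`: the faces that contain `v`. -/
def star {ι : Type*} (K : PreAbstractSimplicialComplex ι) (v : ι) : Set (Finset ι) :=
  {F | F ∈ allFaces K ∧ v ∈ F}

/-- The link of `v` (the empty face included if `v` is a vertex). -/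
def link {ι : Type*} [DecidableEq ι] (K : PreAbstractSimplicialComplex ι) (v : ι) :
    Set (Finset ι) :=
  {F | F ∈ allFaces K ∧ v ∉ F ∧ insert v F ∈ allFaces K}

/-- The join of two families of finite sets on disjoint ground sets. -/
def join {α β : Type*} (A : Set (Finset α)) (B : Set (Finset β)) : Set (Finset (α ⊕ β)) :=
  {s | ∃ F ∈ A, ∃ G ∈ B, s = F.disjSum G}

/-- All faces of the edge `v'v''`, where `false` stands for `v'` and `true` for `v''`. -/
def edgeFaces : Set (Finset Bool) := Set.univ

/-- The proper faces of the edge `v'v''`. -/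
def edgeBoundary : Set (Finset Bool) := {A | A ≠ Finset.univ}

/-- The faces of the one-point suspension, the empty face included. The two new vertices `v'`, `v''`
are `Sum.inl false` and `Sum.inl true`; a vertex `w ≠ v` of `K` becomes `Sum.inr w`, and
`Sum.inr v` is not a vertex any more. -/
def suspFaces {ι : Type*} [DecidableEq ι] (v : ι) (K : PreAbstractSimplicialComplex ι) :
    Set (Finset (Bool ⊕ ι)) :=
  (join edgeBoundary (allFaces K) \ join edgeBoundary (star K v)) ∪ join edgeFaces (link K v)

theorem allFaces_mono {ι : Type*} {K : PreAbstractSimplicialComplex ι} {F G : Finset ι}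
    (hG : G ∈ allFaces K) (h : F ⊆ G) : F ∈ allFaces K := by
  rcases F.eq_empty_or_nonempty with rfl | hF
  · exact Or.inl rfl
  · rcases hG with rfl | hG
    · exact absurd (Finset.subset_empty.1 h) hF.ne_empty
    · exact Or.inr ((K.isRelLowerSet_faces hG).2 h hF)

theorem mem_suspFaces {ι : Type*} [DecidableEq ι] {v : ι} {K : PreAbstractSimplicialComplex ι}
    {s : Finset (Bool ⊕ ι)} :
    s ∈ suspFaces v K ↔
      (s.toLeft ≠ Finset.univ ∧ s.toRight ∈ allFaces K ∧ v ∉ s.toRight) ∨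
        s.toRight ∈ link K v := by
  have key : ∀ (A : Set (Finset Bool)) (B : Set (Finset ι)),
      s ∈ join A B ↔ s.toLeft ∈ A ∧ s.toRight ∈ B := by
    intro A B
    constructor
    · rintro ⟨F, hF, G, hG, rfl⟩
      simpa using ⟨hF, hG⟩
    · rintro ⟨h1, h2⟩
      exact ⟨_, h1, _, h2, Finset.toLeft_disjSum_toRight.symm⟩
  simp only [suspFaces, Set.mem_union, Set.mem_sdiff, key, edgeBoundary, edgeFaces, star,
    Set.mem_ofPred_eq, Set.mem_univ]
  tauto

/-- The one-point suspension of `K` with respect to `v`. -/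
def onePointSuspension {ι : Type*} [DecidableEq ι] (v : ι) (K : PreAbstractSimplicialComplex ι) :
    PreAbstractSimplicialComplex (Bool ⊕ ι) where
  faces := {s | s.Nonempty ∧ s ∈ suspFaces v K}
  isRelLowerSet_faces := by
    rintro s ⟨hs, hsf⟩
    refine ⟨hs, fun t hts ht => ⟨ht, ?_⟩⟩
    have hL : t.toLeft ⊆ s.toLeft := Finset.toLeft_subset_toLeft hts
    have hR : t.toRight ⊆ s.toRight := Finset.toRight_subset_toRight hts
    rw [mem_suspFaces] at hsf ⊢
    rcases hsf with ⟨h1, h2, h3⟩ | ⟨h1, h2, h3⟩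
    · exact Or.inl ⟨fun h => h1 (Finset.univ_subset_iff.1 (h ▸ hL)), allFaces_mono h2 hR,
        fun h => h3 (hR h)⟩
    · exact Or.inr ⟨allFaces_mono h1 hR, fun h => h2 (hR h),
        allFaces_mono h3 (Finset.insert_subset_insert v hR)⟩

/-- `T` is one of the generating sets of the wreath product `∂Δ_d ≀ K`: for some facet `F` of `K`, it
contains all `d + 1` copies of each vertex in `F`, and all but exactly one of the copies of each
vertex of `K` outside `F` (the copy `c v` of `v` is omitted). -/
def IsWreathFacet {ι : Type*} (d : ℕ) (K : PreAbstractSimplicialComplex ι)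
    (T : Finset (ι × Fin (d + 1))) : Prop :=
  ∃ F : Finset ι, Maximal (· ∈ K.faces) F ∧ ∃ c : ι → Fin (d + 1),
    ∀ v i, (v, i) ∈ T ↔ v ∈ vertices K ∧ (v ∈ F ∨ i ≠ c v)

/-- The wreath product `∂Δ_d ≀ K`; the copies of a vertex `v` are the pairs `(v, i)`. -/
def wreathProduct {ι : Type*} (d : ℕ) (K : PreAbstractSimplicialComplex ι) :
    PreAbstractSimplicialComplex (ι × Fin (d + 1)) where
  faces := {s | s.Nonempty ∧ ∃ T, IsWreathFacet d K T ∧ s ⊆ T}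
  isRelLowerSet_faces := by
    rintro s ⟨hs, T, hT, hsT⟩
    exact ⟨hs, fun t hts ht => ⟨ht, T, hT, hts.trans hsT⟩⟩

/-- A convex polytope: the convex hull of a nonempty finite set of points. -/
def IsPolytope {n : ℕ} (P : Set (EuclideanSpace ℝ (Fin n))) : Prop :=
  ∃ X : Finset (EuclideanSpace ℝ (Fin n)), X.Nonempty ∧ P = convexHull ℝ (X : Set _)

/-- `F` is a nonempty proper face of `P`. -/
def IsProperFace {n : ℕ} (P F : Set (EuclideanSpace ℝ (Fin n))) : Prop :=
  IsExposed ℝ P F ∧ F.Nonempty ∧ F ≠ P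

/-- A simplicial polytope: a polytope all of whose proper faces are simplices. -/
def IsSimplicialPolytope {n : ℕ} (P : Set (EuclideanSpace ℝ (Fin n))) : Prop :=
  IsPolytope P ∧ ∀ F, IsProperFace P F →
    AffineIndependent ℝ (fun x : F.extremePoints ℝ => (x : EuclideanSpace ℝ (Fin n)))

/-- The vertex sets of the nonempty proper faces of `P`. -/
def boundaryFaces {n : ℕ} (P : Set (EuclideanSpace ℝ (Fin n))) :
    Set (Finset (EuclideanSpace ℝ (Fin n))) :=
  {s | ∃ F, IsProperFace P F ∧ (s : Set (EuclideanSpace ℝ (Fin n))) = F.extremePoints ℝ}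

/-- `K` is a polytopal sphere: it is isomorphic to the boundary complex of a simplicial polytope. -/
def IsPolytopalSphere {ι : Type*} (K : PreAbstractSimplicialComplex ι) : Prop :=
  ∃ (n : ℕ) (P : Set (EuclideanSpace ℝ (Fin n))), IsSimplicialPolytope P ∧
    ∃ f : ι → EuclideanSpace ℝ (Fin n), Set.InjOn f (vertices K) ∧
      ∀ t : Finset (EuclideanSpace ℝ (Fin n)), t ∈ boundaryFaces P ↔
        ∃ s ∈ K.faces, (t : Set (EuclideanSpace ℝ (Fin n))) = f '' (s : Set ι)

end PolytopalSpheres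

namespace PolytopalSpheres

/-! Polytopality is a property of a space of functions on the vertices. Restricting the affine
functionals to the vertices of a polytope gives a space `U`, and the supporting hyperplanes are its
nonnegative members, so faces are zero sets; this is `Realizes`. Conversely, dividing `U` by a
positive member makes the constants available, and a basis of the result gives coordinates of points
whose convex hull has the prescribed faces.

Both constructions multiply vertices: a projection `π` sends each copy to its original, and a
nonempty set of copies is a face exactly if the originals all of whose copies it contains (its
`fibreCore`) form a face. For nonnegative functions, a sum over a fibre vanishes exactly if every
term does. So pulling `U` back along `fibreSum` realizes the larger complex. For the converse, keep
one copy of each vertex. The remaining copies have empty fibre core, hence form a face, and the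
smaller complex is the link of that face; its function space consists of the functions vanishing on
the discarded copies.

What remains is to verify the fibre core criterion for one-point suspensions and wreath products. -/

/-- A space `U` of real functions on `V` realizes the set family `Φ` if it contains a positive
function and the nonempty members of `Φ` are exactly the nonempty zero sets of the nonzero
nonnegative functions in `U`. -/
def Realizes {V : Type*} (U : Submodule ℝ (V → ℝ)) (Φ : Set (Set V)) : Prop :=
  (∃ u ∈ U, ∀ v, 0 < u v) ∧ ∀ s : Set V, s.Nonempty →
    (s ∈ Φ ↔ ∃ u ∈ U, u ≠ 0 ∧ (∀ v, 0 ≤ u v) ∧ ∀ v, u v = 0 ↔ v ∈ s)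

/-! ### Transfer of realizations along a surjection -/

/-- The points of `V` whose fibre under `π` is contained in `s`. -/
def fibreCore {W V : Type*} (π : W → V) (s : Set W) : Set V := {v | ∀ w, π w = v → w ∈ s}

open Classical in
/-- The sums of a function over the fibres of `π`. -/
noncomputable def fibreSum {W V : Type*} [Fintype W] (π : W → V) : (W → ℝ) →ₗ[ℝ] (V → ℝ) where
  toFun u v := ∑ w with π w = v, u w
  map_add' _ _ := funext fun _ => Finset.sum_add_distrib
  map_smul' _ _ := funext fun _ => (Finset.mul_sum _ _ _).symm

theorem fibreSum_eq_zero_iff {W V : Type*} [Fintype W] (π : W → V) {s : Set W} {u : W → ℝ}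
    (h0 : ∀ w, 0 ≤ u w) (hs : ∀ w, u w = 0 ↔ w ∈ s) (v : V) :
    fibreSum π u v = 0 ↔ v ∈ fibreCore π s := by
  classical
  change ∑ w with π w = v, u w = 0 ↔ _
  rw [Finset.sum_eq_zero_iff_of_nonneg (fun w _ => h0 w)]
  simp [fibreCore, hs]

theorem exists_spread {W V : Type*} [Fintype W] (π : W → V) (s : Set W) (u : V → ℝ)
    (hu : ∀ v, 0 ≤ u v) (hs : ∀ v, u v = 0 ↔ v ∈ fibreCore π s) :
    ∃ u' : W → ℝ, (∀ w, 0 ≤ u' w) ∧ (∀ w, u' w = 0 ↔ w ∈ s) ∧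
      fibreSum π u' = u := by
  classical
  -- The value `u v` is shared equally among the points of the fibre outside `s`, and `N v` counts
  -- them. If `N v = 0`, the fibre lies in `s` and `u v = 0`, so the division by zero is harmless.
  set e : W → ℝ := fun w => if w ∈ s then 0 else 1 with he
  have he0 : ∀ w, 0 ≤ e w := fun w => by simp only [he]; split_ifs <;> norm_num
  have hes : ∀ w, e w = 0 ↔ w ∈ s := fun w => by simp [he]
  set N := fibreSum π e with hN
  have hN0 : ∀ v, 0 ≤ N v := fun v => Finset.sum_nonneg fun w _ => he0 w
  have hNs : ∀ v, N v = 0 ↔ v ∈ fibreCore π s := fibreSum_eq_zero_iff π he0 hes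
  refine ⟨fun w => e w * (u (π w) / N (π w)), fun w => ?_, fun w => ?_, funext fun v => ?_⟩
  · exact mul_nonneg (he0 w) (div_nonneg (hu _) (hN0 _))
  · by_cases hw : w ∈ s
    · simp [hw, (hes w).2 hw]
    · have : π w ∉ fibreCore π s := fun h => hw (h w rfl)
      simp [hw, hes, hs, hNs, this]
  · have h2 : fibreSum π (fun w => e w * (u (π w) / N (π w))) v = N v * (u v / N v) := by
      refine Eq.trans (Finset.sum_congr rfl fun w hw => ?_) (Finset.sum_mul _ _ _).symm
      simp only [(Finset.mem_filter.1 hw).2]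
    rw [h2]
    by_cases h : N v = 0
    · rw [h, zero_mul, (hs v).2 ((hNs v).1 h)]
    · field_simp

/-- Summing over fibres turns a nonnegative function with zero set `s` into one with zero set
`fibreCore π s`, and `exists_spread` reverses this. An empty fibre core has to be treated apart,
since `Realizes` is silent on the empty set; there the positive function is spread. -/
theorem Realizes.comap_fibreSum {W V : Type*} [Fintype W] {π : W → V} (hπ : π.Surjective)
    {Φ : Set (Set V)} {Ψ : Set (Set W)} (h0 : ∅ ∈ Φ)
    (h : ∀ s : Set W, s.Nonempty → (s ∈ Ψ ↔ fibreCore π s ∈ Φ))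
    {U : Submodule ℝ (V → ℝ)} (hU : Realizes U Φ) : Realizes (U.comap (fibreSum π)) Ψ := by
  obtain ⟨⟨p, hpU, hp⟩, hf⟩ := hU
  have hspread : ∀ s : Set W, ∀ u ∈ U, (∀ v, 0 ≤ u v) → (∀ v, u v = 0 ↔ v ∈ fibreCore π s) →
      ∃ u' ∈ U.comap (fibreSum π), (∀ w, 0 ≤ u' w) ∧ (∀ w, u' w = 0 ↔ w ∈ s) ∧
        (u ≠ 0 → u' ≠ 0) := by
    intro s u hu h1 h2
    obtain ⟨u', h3, h4, h5⟩ := exists_spread π s u h1 h2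
    refine ⟨u', ?_, h3, h4, ?_⟩
    · rwa [Submodule.mem_comap, h5]
    · rintro h rfl
      exact h (by rw [← h5, map_zero])
  refine ⟨?_, fun s hs => (h s hs).trans ⟨fun hc => ?_, ?_⟩⟩
  · obtain ⟨u', h1, h2, h3, -⟩ := hspread ∅ p hpU (fun v => (hp v).le) (fun v => by
      obtain ⟨w, rfl⟩ := hπ v
      simp only [(hp _).ne', fibreCore, false_iff]
      exact fun h => h w rfl)
    exact ⟨u', h1, fun w => (h2 w).lt_of_ne fun h => (h3 w).1 h.symm⟩
  · obtain ⟨u, huU, hu0, hu1, hu2⟩ : ∃ u ∈ U, u ≠ 0 ∧ (∀ v, 0 ≤ u v) ∧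
        ∀ v, u v = 0 ↔ v ∈ fibreCore π s := by
      rcases (fibreCore π s).eq_empty_or_nonempty with he | hne
      · refine ⟨p, hpU, ?_, fun v => (hp v).le, fun v => by simp [he, (hp v).ne']⟩
        rintro rfl
        exact (hp (π hs.some)).ne rfl
      · exact (hf _ hne).1 hc
    obtain ⟨u', h1, h2, h3, h4⟩ := hspread s u huU hu1 hu2
    exact ⟨u', h1, h4 hu0, h2, h3⟩
  · rintro ⟨u', hu'U, hu'0, hu'1, hu'2⟩
    have hzero := fibreSum_eq_zero_iff π hu'1 hu'2
    rcases (fibreCore π s).eq_empty_or_nonempty with he | hne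
    · rwa [he]
    · refine (hf _ hne).2 ⟨_, hu'U, fun h => hu'0 (funext fun w => ?_), fun v => ?_, hzero⟩
      · exact (hu'2 w).2 ((hzero (π w)).1 (congrFun h (π w)) w rfl)
      · exact Finset.sum_nonneg fun w _ => hu'1 w

/-- With a section `σ` of `π`, this is passage to the link of the face `(Set.range σ)ᶜ`: extension
by zero identifies functions on `V` with functions on `W` that vanish there. -/
theorem exists_realizes_of_fibreCore {W V : Type*} {π : W → V} (hπ : π.Surjective)
    {Φ : Set (Set V)} {Ψ : Set (Set W)} (h0 : ∅ ∈ Φ)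
    (h : ∀ s : Set W, s.Nonempty → (s ∈ Ψ ↔ fibreCore π s ∈ Φ))
    {U' : Submodule ℝ (W → ℝ)} (hU : Realizes U' Ψ) :
    ∃ U : Submodule ℝ (V → ℝ), Realizes U Φ := by
  obtain ⟨σ, hσ⟩ := hπ.hasRightInverse
  obtain ⟨⟨p, hpU, hp⟩, hf⟩ := hU
  let ex : (V → ℝ) →ₗ[ℝ] (W → ℝ) := Function.ExtendByZero.linearMap ℝ σ
  have exσ : ∀ u v, ex u (σ v) = u v := fun u v => hσ.injective.extend_apply _ _ _
  have exc : ∀ u w, w ∉ Set.range σ → ex u w = 0 := fun u w hw =>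
    Function.extend_apply' _ _ _ (fun h => hw h)
  have hcore : ∀ s, fibreCore π (σ '' s ∪ (Set.range σ)ᶜ) = s := by
    intro s
    ext v
    constructor
    · intro hv
      rcases hv (σ v) (hσ v) with ⟨v', hv', h⟩ | h
      · exact hσ.injective h ▸ hv'
      · exact absurd ⟨v, rfl⟩ h
    · rintro hv w rfl
      by_cases hw : w ∈ Set.range σ
      · obtain ⟨v, rfl⟩ := hw
        exact Or.inl ⟨v, by rwa [hσ v] at hv, rfl⟩
      · exact Or.inr hw
  have hmem : ∀ s v, σ v ∈ σ '' s ∪ (Set.range σ)ᶜ ↔ v ∈ s := by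
    intro s v
    simp [hσ.injective.eq_iff]
  have hback : ∀ (s : Set V) (u' : W → ℝ), (∀ w, u' w = 0 ↔ w ∈ σ '' s ∪ (Set.range σ)ᶜ) →
      ex (u' ∘ σ) = u' := by
    intro s u' hu'
    funext w
    by_cases hw : w ∈ Set.range σ
    · obtain ⟨v, rfl⟩ := hw
      exact exσ _ _
    · rw [exc _ _ hw, (hu' w).2 (Or.inr hw)]
  refine ⟨U'.comap ex, ?_, fun s hs => ?_⟩
  -- The positive function: if copies are discarded, they form a face, and a function vanishing
  -- exactly on that face is positive on the chosen copies.
  · rcases (Set.range σ)ᶜ.eq_empty_or_nonempty with he | hne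
    · refine ⟨p ∘ σ, ?_, fun v => hp _⟩
      rw [Submodule.mem_comap, hback ∅ p (fun w => by simp [he, (hp w).ne'])]
      exact hpU
    · have h1 := hcore ∅
      simp only [Set.image_empty, Set.empty_union] at h1
      obtain ⟨u', hu'U, -, hu'1, hu'2⟩ := (hf _ hne).1 ((h _ hne).2 (h1 ▸ h0))
      refine ⟨u' ∘ σ, ?_, fun v => (hu'1 _).lt_of_ne fun h => ?_⟩
      · rw [Submodule.mem_comap, hback ∅ u' (by simpa using hu'2)]
        exact hu'U
      · exact (hu'2 _).1 h.symm ⟨v, rfl⟩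
  · have hne : (σ '' s ∪ (Set.range σ)ᶜ).Nonempty := (hs.image σ).inl
    have h1 := h _ hne
    rw [hcore, hf _ hne] at h1
    rw [← h1]
    constructor
    · rintro ⟨u', hu'U, hu'0, hu'1, hu'2⟩
      have hb := hback s u' hu'2
      refine ⟨u' ∘ σ, ?_, ?_, fun v => hu'1 _, fun v => (hu'2 _).trans (hmem s v)⟩
      · rw [Submodule.mem_comap, hb]
        exact hu'U
      · intro h0
        rw [h0, map_zero] at hb
        exact hu'0 hb.symm
    · rintro ⟨u, huU, hu0, hu1, hu2⟩
      refine ⟨ex u, huU, ?_, fun w => ?_, fun w => ?_⟩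
      · intro h0
        exact hu0 (funext fun v => by rw [← exσ u v, h0]; rfl)
      · by_cases hw : w ∈ Set.range σ
        · obtain ⟨v, rfl⟩ := hw
          rw [exσ]
          exact hu1 v
        · rw [exc _ _ hw]
      · by_cases hw : w ∈ Set.range σ
        · obtain ⟨v, rfl⟩ := hw
          rw [exσ, hmem, hu2]
        · simp only [exc _ _ hw, true_iff]
          exact Or.inr hw

/-! ### From polytopes to function spaces -/

/-- The faces of `K`, the empty face included, as sets of vertices. -/
def vertexFaces {ι : Type*} (K : PreAbstractSimplicialComplex ι) : Set (Set (vertices K)) :=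
  {s | ∃ F ∈ allFaces K, Subtype.val '' s = (F : Set ι)}

theorem empty_mem_vertexFaces {ι : Type*} (K : PreAbstractSimplicialComplex ι) :
    ∅ ∈ vertexFaces K := ⟨∅, Or.inl rfl, by simp⟩

theorem nonempty_of_mem_faces {ι : Type*} {K : PreAbstractSimplicialComplex ι} {F : Finset ι}
    (hF : F ∈ K.faces) : F.Nonempty := (K.isRelLowerSet_faces hF).1

theorem mem_vertices_of_mem_faces {ι : Type*} {K : PreAbstractSimplicialComplex ι} {F : Finset ι}
    (hF : F ∈ K.faces) {v : ι} (hv : v ∈ F) : v ∈ vertices K :=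
  (K.isRelLowerSet_faces hF).2 (Finset.singleton_subset_iff.2 hv) (Finset.singleton_nonempty v)

theorem mem_vertexFaces_iff {ι : Type*} {K : PreAbstractSimplicialComplex ι}
    {s : Set (vertices K)} (hs : s.Nonempty) :
    s ∈ vertexFaces K ↔ ∃ F ∈ K.faces, Subtype.val '' s = (F : Set ι) := by
  constructor
  · rintro ⟨F, rfl | hF, h⟩
    · simp [hs.ne_empty] at h
    · exact ⟨F, hF, h⟩
  · rintro ⟨F, hF, h⟩
    exact ⟨F, Or.inr hF, h⟩

theorem mem_vertexFaces_mono {ι : Type*} {K : PreAbstractSimplicialComplex ι}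
    {s t : Set (vertices K)} (ht : t ∈ vertexFaces K) (hst : s ⊆ t) : s ∈ vertexFaces K := by
  obtain ⟨F, hF, h⟩ := ht
  have hfin : (Subtype.val '' s : Set ι).Finite :=
    F.finite_toSet.subset (h ▸ Set.image_mono hst)
  refine ⟨hfin.toFinset, allFaces_mono hF ?_, by simp⟩
  rw [← Finset.coe_subset, hfin.coe_toFinset, ← h]
  exact Set.image_mono hst

theorem singleton_mem_vertexFaces {ι : Type*} {K : PreAbstractSimplicialComplex ι}
    (v : vertices K) : {v} ∈ vertexFaces K := ⟨{↑v}, Or.inr v.2, by simp⟩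

/-- The restrictions to a point configuration of the affine functionals. -/
def affineValues {V E : Type*} [NormedAddCommGroup E] [NormedSpace ℝ E] (p : V → E) :
    Submodule ℝ (V → ℝ) where
  carrier := {u | ∃ (l : StrongDual ℝ E) (c : ℝ), ∀ v, u v = c - l (p v)}
  add_mem' := by
    rintro a b ⟨l, c, h⟩ ⟨l', c', h'⟩
    exact ⟨l + l', c + c', fun v => by simp [h, h']; ring⟩
  zero_mem' := ⟨0, 0, by simp⟩
  smul_mem' := by
    rintro r a ⟨l, c, h⟩
    exact ⟨r • l, r * c, fun v => by simp [h]; ring⟩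

theorem mem_affineValues {V E : Type*} [NormedAddCommGroup E] [NormedSpace ℝ E] {p : V → E}
    {u : V → ℝ} : u ∈ affineValues p ↔ ∃ (l : StrongDual ℝ E) (c : ℝ), ∀ v, u v = c - l (p v) :=
  Iff.rfl

theorem IsPolytope.isCompact {n : ℕ} {P : Set (EuclideanSpace ℝ (Fin n))} (hP : IsPolytope P) :
    IsCompact P := by
  obtain ⟨X, -, rfl⟩ := hP
  exact X.finite_toSet.isCompact_convexHull ℝ

theorem IsPolytope.nonempty {n : ℕ} {P : Set (EuclideanSpace ℝ (Fin n))} (hP : IsPolytope P) :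
    P.Nonempty := by
  obtain ⟨X, hX, rfl⟩ := hP
  exact (Finset.coe_nonempty.2 hX).convexHull

theorem IsPolytope.exists_boundaryFace {n : ℕ} {P F : Set (EuclideanSpace ℝ (Fin n))}
    (hP : IsPolytope P) (hF : IsProperFace P F) :
    ∃ t ∈ boundaryFaces P, (t : Set (EuclideanSpace ℝ (Fin n))) = F.extremePoints ℝ ∧
      t.Nonempty := by
  have hfin : (F.extremePoints ℝ).Finite := by
    have h := hF.1.isExtreme.extremePoints_subset_extremePoints
    obtain ⟨X, -, rfl⟩ := hP
    exact X.finite_toSet.subset (h.trans extremePoints_convexHull_subset)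
  refine ⟨hfin.toFinset, ⟨F, hF, hfin.coe_toFinset⟩, hfin.coe_toFinset, ?_⟩
  rw [Set.Finite.toFinset_nonempty]
  exact (hF.1.isCompact hP.isCompact).extremePoints_nonempty hF.2.1

/-- The slack `c - l` of a supporting hyperplane vanishes at exactly the vertices of the face that
it cuts out. -/
theorem IsPolytopalSphere.exists_realizes {ι : Type*} {K : PreAbstractSimplicialComplex ι}
    (hK : IsPolytopalSphere K) :
    ∃ U : Submodule ℝ (vertices K → ℝ), Realizes U (vertexFaces K) := by
  obtain ⟨n, P, ⟨hP, -⟩, f, hf, hface⟩ := hK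
  have hext : ∀ v : vertices K, f v ∈ P.extremePoints ℝ := by
    intro v
    obtain ⟨F, hF, h⟩ := (hface {f v}).2 ⟨{↑v}, v.2, by simp⟩
    exact hF.1.isExtreme.extremePoints_subset_extremePoints (h ▸ by simp)
  have hinj : ∀ (v : vertices K), ∀ s ∈ K.faces, f v ∈ f '' (s : Set ι) → (v : ι) ∈ s := by
    rintro v s hs ⟨w, hw, h⟩
    exact hf (mem_vertices_of_mem_faces hs hw) v.2 h ▸ hw
  -- the face of `P` on which a linear functional is maximal
  have hmax : ∀ l : StrongDual ℝ (EuclideanSpace ℝ (Fin n)), ∃ x ∈ P, (∀ y ∈ P, l y ≤ l x) ∧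
      ((∃ y ∈ P, l y ≠ l x) → ∃ s ∈ K.faces, ∀ v : vertices K, ↑v ∈ s ↔ l (f v) = l x) := by
    intro l
    obtain ⟨x, hxP, hx⟩ := hP.isCompact.exists_isMaxOn hP.nonempty l.continuous.continuousOn
    refine ⟨x, hxP, fun y hy => hx hy, ?_⟩
    rintro ⟨y, hyP, hy⟩
    have hF : IsProperFace P (l.toExposed P) := by
      refine ⟨ContinuousLinearMap.toExposed.isExposed, ⟨x, hxP, fun y hy => hx hy⟩, fun h => ?_⟩
      have : y ∈ l.toExposed P := h.symm.subset hyP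
      exact hy (le_antisymm (hx hyP) (this.2 x hxP))
    obtain ⟨t, htb, ht, -⟩ := hP.exists_boundaryFace hF
    obtain ⟨s, hs, hst⟩ := (hface t).1 htb
    refine ⟨s, hs, fun v => ?_⟩
    have h1 : (v : ι) ∈ s ↔ f v ∈ f '' (s : Set ι) := ⟨fun h => ⟨v, h, rfl⟩, hinj v s hs⟩
    rw [h1, ← hst, ht, hF.1.isExtreme.extremePoints_eq]
    constructor
    · rintro ⟨h, -⟩
      exact le_antisymm (hx h.1) (h.2 x hxP)
    · intro h
      exact ⟨⟨(hext v).1, fun y hy => h ▸ hx hy⟩, hext v⟩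
  refine ⟨affineValues fun v : vertices K => f v, ⟨fun _ => 1, ⟨0, 1, by simp⟩, by simp⟩,
    fun s hs => ?_⟩
  rw [mem_vertexFaces_iff hs]
  constructor
  · rintro ⟨F, hFK, hF⟩
    obtain ⟨G, hG, hGt⟩ := (hface (F.image f)).2 ⟨F, hFK, by simp⟩
    obtain ⟨l, hl⟩ := hG.1 hG.2.1
    obtain ⟨x, hxP, hx, hx'⟩ := hmax l
    have hGl : ∀ y, y ∈ G ↔ y ∈ P ∧ l y = l x := by
      intro y
      rw [hl]
      exact ⟨fun h => ⟨h.1, le_antisymm (hx y h.1) (h.2 x hxP)⟩,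
        fun h => ⟨h.1, fun z hz => h.2 ▸ hx z hz⟩⟩
    have hsF : ∀ v : vertices K, l (f v) = l x ↔ v ∈ s := by
      intro v
      have h1 : v ∈ s ↔ (v : ι) ∈ F := by
        rw [← Finset.mem_coe, ← hF]
        simp
      have h2 : (v : ι) ∈ F ↔ f v ∈ f '' (F : Set ι) := ⟨fun h => ⟨v, h, rfl⟩, hinj v F hFK⟩
      rw [h1, h2, ← Finset.coe_image, hGt, hG.1.isExtreme.extremePoints_eq]
      exact ⟨fun h => ⟨(hGl _).2 ⟨(hext v).1, h⟩, hext v⟩, fun h => ((hGl _).1 h.1).2⟩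
    obtain ⟨y, hyP, hy⟩ : ∃ y ∈ P, l y ≠ l x := by
      by_contra! h
      exact hG.2.2 (Set.Subset.antisymm hG.1.subset fun y hy => (hGl y).2 ⟨hy, h y hy⟩)
    refine ⟨fun v => l x - l (f v), ⟨l, l x, fun v => rfl⟩, fun h0 => ?_,
      fun v => sub_nonneg.2 (hx _ (hext v).1), fun v => ?_⟩
    -- The slack is nonzero because the face where `l` is minimal is proper as well and contains a
    -- vertex coming from `K`.
    · obtain ⟨z, hzP, hz, hz'⟩ := hmax (-l)
      simp only [neg_apply, neg_le_neg_iff, ne_eq, neg_inj] at hz hz'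
      have hzx : l z ≠ l x := fun h => hy (le_antisymm (hx y hyP) (h ▸ hz y hyP))
      obtain ⟨s', hs', hs'v⟩ := hz' ⟨x, hxP, hzx.symm⟩
      obtain ⟨v, hv⟩ := nonempty_of_mem_faces hs'
      have h1 := (hs'v ⟨v, mem_vertices_of_mem_faces hs' hv⟩).1 hv
      have h2 := congrFun h0 ⟨v, mem_vertices_of_mem_faces hs' hv⟩
      simp only [Pi.zero_apply, sub_eq_zero] at h2
      exact hzx (h1.symm.trans h2.symm)
    · rw [sub_eq_zero, eq_comm, hsF]
  · rintro ⟨u, ⟨l, c, hu⟩, hu0, hu1, hu2⟩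
    obtain ⟨x, hxP, hx, hx'⟩ := hmax l
    obtain ⟨v₀, hv₀⟩ := hs
    have hc : c = l (f v₀) := by
      have := (hu2 v₀).2 hv₀
      rw [hu] at this
      linarith
    obtain ⟨v₁, hv₁⟩ : ∃ v, u v ≠ 0 := Function.ne_iff.1 hu0
    have hne : ∃ y ∈ P, l y ≠ l x := by
      by_contra! h
      refine hv₁ ?_
      rw [hu, hc, h _ (hext v₀).1, h _ (hext v₁).1, sub_self]
    obtain ⟨F, hFK, hF⟩ := hx' hne
    -- Nonnegativity at a vertex of the maximal face gives `l x ≤ c`, and the zero at `v₀` gives `c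
    -- ≤ l x`.
    have hcx : c = l x := by
      obtain ⟨w, hw⟩ := nonempty_of_mem_faces hFK
      have h1 := (hF ⟨w, mem_vertices_of_mem_faces hFK hw⟩).1 hw
      have h2 := hu1 ⟨w, mem_vertices_of_mem_faces hFK hw⟩
      rw [hu, h1] at h2
      have h3 := hx _ (hext v₀).1
      linarith
    refine ⟨F, hFK, ?_⟩
    ext w
    constructor
    · rintro ⟨v, hv, rfl⟩
      have := (hu2 v).2 hv
      rw [hu, hcx] at this
      exact (hF v).2 (by linarith)
    · intro hw
      refine ⟨⟨w, mem_vertices_of_mem_faces hFK hw⟩, (hu2 _).1 ?_, rfl⟩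
      rw [hu, hcx, (hF ⟨w, mem_vertices_of_mem_faces hFK hw⟩).1 hw, sub_self]

/-! ### From function spaces to polytopes -/

/-- Multiplication by a positive function preserves signs and zero sets, so `U` may be replaced by
`p⁻¹ * U`, which contains the constants. Coordinates from a basis then make the affine functionals
on the points exactly this space. -/
theorem Realizes.exists_affineValues {V : Type*} [Finite V] {U : Submodule ℝ (V → ℝ)}
    {Φ : Set (Set V)} (hU : Realizes U Φ) :
    ∃ (n : ℕ) (q : V → EuclideanSpace ℝ (Fin n)), Realizes (affineValues q) Φ := by
  obtain ⟨⟨p, hpU, hp⟩, hf⟩ := hU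
  let b := Module.finBasis ℝ U
  let q : V → EuclideanSpace ℝ (Fin (Module.finrank ℝ U)) :=
    fun v => WithLp.toLp 2 fun i => (b i : V → ℝ) v / p v
  have hq : ∀ v i, q v i = (b i : V → ℝ) v / p v := fun v i => rfl
  have key : ∀ u : V → ℝ, u ∈ affineValues q ↔ p * u ∈ U := by
    intro u
    rw [mem_affineValues]
    constructor
    · rintro ⟨l, c, hu⟩
      have hl : ∀ x, l x = ∑ i, x i * l (EuclideanSpace.single i 1) := by
        intro x
        conv_lhs => rw [← (EuclideanSpace.basisFun (Fin _) ℝ).sum_repr x]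
        simp
      have : p * u = c • p - ∑ i, l (EuclideanSpace.single i 1) • (b i : V → ℝ) := by
        funext v
        have hpv := (hp v).ne'
        simp only [Pi.mul_apply, hu, hl (q v), hq, Pi.sub_apply, Pi.smul_apply, smul_eq_mul,
          Finset.sum_apply, mul_sub, Finset.mul_sum]
        congr 1
        · ring
        · exact Finset.sum_congr rfl fun i _ => by field_simp
      rw [this]
      exact U.sub_mem (U.smul_mem _ hpU) (U.sum_mem fun i _ => U.smul_mem _ (b i).2)
    · intro hu
      refine ⟨-∑ i, b.repr ⟨_, hu⟩ i • EuclideanSpace.proj i, 0, fun v => ?_⟩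
      have h1 := congrFun (congrArg Subtype.val (b.sum_repr ⟨_, hu⟩)) v
      simp only [Submodule.coe_sum, Submodule.coe_smul, Finset.sum_apply, Pi.smul_apply,
        smul_eq_mul, Pi.mul_apply] at h1
      have hpv := (hp v).ne'
      have hproj : ∀ i, EuclideanSpace.proj (𝕜 := ℝ) i (q v) = (b i : V → ℝ) v / p v := hq v
      simp only [neg_apply, sum_apply, smul_apply, hproj, zero_sub, neg_neg, smul_eq_mul]
      rw [eq_comm, ← mul_left_cancel_iff_of_pos (hp v), ← h1, Finset.mul_sum]
      exact Finset.sum_congr rfl fun i _ => by field_simp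
  refine ⟨_, q, ⟨fun _ => 1, ⟨0, 1, by simp⟩, by simp⟩, fun s hs => (hf s hs).trans ?_⟩
  constructor
  · rintro ⟨u, huU, hu0, hu1, hu2⟩
    have hpu : p * (p⁻¹ * u) = u := by
      funext v
      have hpv := (hp v).ne'
      simp only [Pi.mul_apply, Pi.inv_apply]
      field_simp
    refine ⟨p⁻¹ * u, (key _).2 (hpu.symm ▸ huU :), ?_, fun v => ?_, fun v => ?_⟩
    · intro h
      rw [h, mul_zero] at hpu
      exact hu0 hpu.symm
    · exact mul_nonneg (inv_nonneg.2 (hp v).le) (hu1 v)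
    · simp [(hp v).ne', hu2]
  · rintro ⟨u, huU, hu0, hu1, hu2⟩
    refine ⟨p * u, (key _).1 huU, ?_, fun v => mul_nonneg (hp v).le (hu1 v), fun v => ?_⟩
    · obtain ⟨v, hv⟩ := Function.ne_iff.1 hu0
      exact Function.ne_iff.2 ⟨v, mul_ne_zero (hp v).ne' hv⟩
    · simp [(hp v).ne', hu2]

theorem isPolytopalSphere_of_isEmpty_vertices {ι : Type*} {K : PreAbstractSimplicialComplex ι}
    (h : vertices K = ∅) : IsPolytopalSphere K := by
  have hproper : ∀ F, ¬ IsProperFace ({0} : Set (EuclideanSpace ℝ (Fin 0))) F := by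
    rintro F ⟨h1, h2, h3⟩
    exact h3 ((Set.subset_singleton_iff_eq.1 h1.subset).resolve_left h2.ne_empty)
  -- A single point has no nonempty proper face, so its boundary complex is `{∅}`.
  refine ⟨0, {0}, ⟨⟨{0}, by simp, by simp⟩, fun F hF => absurd hF (hproper F)⟩, fun _ => 0,
    by simp [h], fun t => ⟨?_, ?_⟩⟩
  · rintro ⟨F, hF, -⟩
    exact absurd hF (hproper F)
  · rintro ⟨s, hs, -⟩
    obtain ⟨v, hv⟩ := nonempty_of_mem_faces hs
    exact absurd (mem_vertices_of_mem_faces hs hv) (h ▸ Set.notMem_empty v)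

/-- Singletons of vertices are faces, so the points are distinct and extreme. Simpliciality comes
from closure under subsets: deleting one vertex from a face leaves a face or nothing, so some affine
functional separates that vertex from the others. -/
theorem Realizes.isPolytopalSphere {ι : Type*} {K : PreAbstractSimplicialComplex ι}
    (hfin : (vertices K).Finite) {U : Submodule ℝ (vertices K → ℝ)}
    (hU : Realizes U (vertexFaces K)) : IsPolytopalSphere K := by
  classical
  rcases (vertices K).eq_empty_or_nonempty with hV | hV
  · exact isPolytopalSphere_of_isEmpty_vertices hV
  have := hfin.to_subtype
  have hVne : Nonempty (vertices K) := hV.to_subtype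
  obtain ⟨n, q, -, hf⟩ := hU.exists_affineValues
  set P := convexHull ℝ (Set.range q) with hPdef
  have hP : IsPolytope P :=
    ⟨(Set.finite_range q).toFinset, by simpa using Set.range_nonempty q, by simp [hPdef]⟩
  have hqP : ∀ v, q v ∈ P := fun v => subset_convexHull ℝ _ ⟨v, rfl⟩
  have hle : ∀ (l : StrongDual ℝ (EuclideanSpace ℝ (Fin n))) (c : ℝ), (∀ v, l (q v) ≤ c) →
      ∀ x ∈ P, l x ≤ c := by
    intro l c h x hx
    have hsub : P ⊆ {x | l x ≤ c} :=
      convexHull_min (by rintro _ ⟨v, rfl⟩; exact h v)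
        (convex_halfSpace_le l.toLinearMap.isLinear c)
    exact hsub hx
  -- the face cut out by a supporting hyperplane
  have hexp : ∀ s : Set (vertices K), s ∈ vertexFaces K → s.Nonempty →
      ∃ F, IsProperFace P F ∧ ∀ v, q v ∈ F ↔ v ∈ s := by
    intro s hsK hs
    obtain ⟨u, ⟨l, c, hu⟩, hu0, hu1, hu2⟩ := (hf s hs).1 hsK
    have hlc : ∀ x ∈ P, l x ≤ c := hle l c fun v => by have := hu1 v; rw [hu] at this; linarith
    obtain ⟨v₀, hv₀⟩ := hs
    have hv₀c : l (q v₀) = c := by have := (hu2 v₀).2 hv₀; rw [hu] at this; linarith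
    have hmem : ∀ v, q v ∈ l.toExposed P ↔ v ∈ s := by
      intro v
      rw [← hu2, hu]
      constructor
      · intro h
        have h1 := h.2 _ (hqP v₀)
        have h2 := hlc _ h.1
        linarith
      · intro h
        exact ⟨hqP v, fun y hy => (hlc y hy).trans (by linarith)⟩
    refine ⟨l.toExposed P, ⟨ContinuousLinearMap.toExposed.isExposed,
      ⟨q v₀, (hmem v₀).2 hv₀⟩, fun h => ?_⟩, hmem⟩
    obtain ⟨v, hv⟩ := Function.ne_iff.1 hu0
    exact hv ((hu2 v).2 ((hmem v).1 (h.symm.subset (hqP v))))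
  have hqinj : Function.Injective q := by
    intro v w hvw
    obtain ⟨F, -, hF⟩ := hexp {w} (singleton_mem_vertexFaces w) ⟨w, rfl⟩
    exact (hF v).1 (hvw ▸ (hF w).2 rfl)
  have hPext : ∀ v, q v ∈ P.extremePoints ℝ := by
    intro v
    obtain ⟨F, hF, hFv⟩ := hexp {v} (singleton_mem_vertexFaces v) ⟨v, rfl⟩
    obtain ⟨x, hx⟩ := (hF.1.isCompact hP.isCompact).extremePoints_nonempty hF.2.1
    have hxP := hF.1.isExtreme.extremePoints_subset_extremePoints hx
    obtain ⟨w, rfl⟩ := extremePoints_convexHull_subset hxP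
    exact (hFv w).1 hx.1 ▸ hxP
  have hFext : ∀ F, IsProperFace P F → F.extremePoints ℝ = q '' {v | q v ∈ F} := by
    intro F hF
    rw [hF.1.isExtreme.extremePoints_eq]
    ext x
    constructor
    · rintro ⟨h1, h2⟩
      obtain ⟨v, rfl⟩ := extremePoints_convexHull_subset h2
      exact ⟨v, h1, rfl⟩
    · rintro ⟨v, hv, rfl⟩
      exact ⟨hv, hPext v⟩
  have hFK : ∀ F, IsProperFace P F → {v | q v ∈ F} ∈ vertexFaces K ∧ {v | q v ∈ F}.Nonempty := by
    intro F hF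
    have hne : {v | q v ∈ F}.Nonempty := by
      have := (hF.1.isCompact hP.isCompact).extremePoints_nonempty hF.2.1
      rw [hFext F hF] at this
      exact this.of_image
    refine ⟨(hf _ hne).2 ?_, hne⟩
    obtain ⟨l, hl⟩ := hF.1 hF.2.1
    obtain ⟨x, hx⟩ := hF.2.1
    have hx' := hl ▸ hx
    refine ⟨fun v => l x - l (q v), ⟨l, l x, fun v => rfl⟩, fun h => ?_,
      fun v => sub_nonneg.2 (hx'.2 _ (hqP v)), fun v => ?_⟩
    · refine hF.2.2 (Set.Subset.antisymm hF.1.subset (convexHull_min ?_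
        (hF.1.convex (convex_convexHull ℝ _))))
      rintro _ ⟨v, rfl⟩
      have hv : l x = l (q v) := sub_eq_zero.1 (congrFun h v)
      rw [hl]
      exact ⟨hqP v, fun y hy => hv ▸ hx'.2 y hy⟩
    · rw [sub_eq_zero, Set.mem_ofPred_eq, hl]
      exact ⟨fun hv => ⟨hqP v, fun y hy => hv ▸ hx'.2 y hy⟩,
        fun hv => le_antisymm (hv.2 x hx'.1) (hx'.2 _ (hqP v))⟩
  have haff : ∀ F, IsProperFace P F →
      AffineIndependent ℝ (fun x : F.extremePoints ℝ => (x : EuclideanSpace ℝ (Fin n))) := by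
    intro F hF
    obtain ⟨hsK, -⟩ := hFK F hF
    rw [affineIndependent_iff]
    intro T w hw0 hw1 e heT
    have hmem : ∀ x : F.extremePoints ℝ, ∃ v, q v ∈ F ∧ q v = x := fun x =>
      (hFext F hF).subset x.2
    obtain ⟨v, hvF, hve⟩ := hmem e
    -- Applied to an affine dependence, a functional vanishing at every vertex of `F` except `q v`
    -- isolates the coefficient of `q v`. If `F` has no other vertex, the constant 1 serves.
    obtain ⟨l, c, hv, hother⟩ : ∃ (l : StrongDual ℝ (EuclideanSpace ℝ (Fin n))) (c : ℝ),
        c - l (q v) ≠ 0 ∧ ∀ v', q v' ∈ F → v' ≠ v → c - l (q v') = 0 := by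
      rcases ({v | q v ∈ F} \ {v}).eq_empty_or_nonempty with he | hne
      · refine ⟨0, 1, by simp, fun v' h1 h2 => ?_⟩
        have : v' ∈ ({v | q v ∈ F} \ {v} : Set _) := ⟨h1, h2⟩
        simp [he] at this
      · obtain ⟨u, ⟨l, c, hu⟩, -, -, hu2⟩ := (hf _ hne).1 (mem_vertexFaces_mono hsK Set.sdiff_subset)
        refine ⟨l, c, ?_, fun v' h1 h2 => ?_⟩
        · rw [← hu, ne_eq, hu2]
          simp
        · rw [← hu, hu2]
          exact ⟨h1, h2⟩
    have hsum : ∑ x ∈ T, w x * (c - l x) = 0 := by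
      have := congrArg l hw1
      simp only [map_sum, map_smul, smul_eq_mul, map_zero] at this
      simp only [mul_sub, Finset.sum_sub_distrib, ← Finset.sum_mul, hw0, this]
      simp
    rw [Finset.sum_eq_single_of_mem e heT] at hsum
    · rw [← hve] at hsum
      exact (mul_eq_zero.1 hsum).resolve_right hv
    · intro x _ hxe
      obtain ⟨v', hv'F, hv'⟩ := hmem x
      rw [← hv', hother v' hv'F, mul_zero]
      rintro rfl
      exact hxe (Subtype.ext (hv'.symm.trans hve))
  let f : ι → EuclideanSpace ℝ (Fin n) := fun v => if h : v ∈ vertices K then q ⟨v, h⟩ else 0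
  have hfq : ∀ v : vertices K, f v = q v := fun v => by simp [f]
  have himage : ∀ s : Set (vertices K), f '' (Subtype.val '' s) = q '' s := fun s => by
    rw [Set.image_image]
    exact Set.image_congr fun v _ => hfq v
  refine ⟨n, P, ⟨hP, haff⟩, f, ?_, fun t => ⟨?_, ?_⟩⟩
  · intro v hv w hw h
    rw [hfq ⟨v, hv⟩, hfq ⟨w, hw⟩] at h
    exact congrArg Subtype.val (hqinj h)
  · rintro ⟨F, hF, ht⟩
    obtain ⟨hs, hne⟩ := hFK F hF
    obtain ⟨G, hG, hGs⟩ := (mem_vertexFaces_iff hne).1 hs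
    exact ⟨G, hG, by rw [ht, hFext F hF, ← himage, hGs]⟩
  · rintro ⟨G, hG, ht⟩
    have hGs : Subtype.val '' {v : vertices K | (v : ι) ∈ G} = (G : Set ι) := by
      ext v
      simpa using fun h => mem_vertices_of_mem_faces hG h
    have hne : {v : vertices K | (v : ι) ∈ G}.Nonempty := by
      obtain ⟨v, hv⟩ := nonempty_of_mem_faces hG
      exact ⟨⟨v, mem_vertices_of_mem_faces hG hv⟩, hv⟩
    obtain ⟨F, hF, hFG⟩ := hexp _ ⟨G, Or.inr hG, hGs⟩ hne
    refine ⟨F, hF, ?_⟩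
    rw [ht, hFext F hF, ← hGs, himage]
    congr 1
    ext v
    exact (hFG v).symm

/-! ### The fibre core criterion for complexes -/

theorem isPolytopalSphere_iff_of_fibreCore {ι κ : Type*} {K : PreAbstractSimplicialComplex ι}
    {L : PreAbstractSimplicialComplex κ} (hK : (vertices K).Finite) (hL : (vertices L).Finite)
    {π : vertices L → vertices K} (hπ : π.Surjective)
    (h : ∀ s : Set (vertices L), s.Nonempty → (s ∈ vertexFaces L ↔ fibreCore π s ∈ vertexFaces K)) :
    IsPolytopalSphere L ↔ IsPolytopalSphere K := by
  have := hL.fintype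
  have h0 := empty_mem_vertexFaces K
  constructor
  · intro hLp
    obtain ⟨U', hU'⟩ := hLp.exists_realizes
    obtain ⟨U, hU⟩ := exists_realizes_of_fibreCore hπ h0 h hU'
    exact hU.isPolytopalSphere hK
  · intro hKp
    obtain ⟨U, hU⟩ := hKp.exists_realizes
    exact (hU.comap_fibreSum hπ h0 h).isPolytopalSphere hL

theorem finite_vertices {ι : Type*} {K : PreAbstractSimplicialComplex ι} (hK : K.faces.Finite) :
    (vertices K).Finite :=
  hK.preimage (Finset.singleton_injective.injOn)

/-- If the vertices of `L` are obtained by multiplying those of `K`, and a set of vertices is a face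
of `L` exactly if the vertices of `K` all of whose copies it contains form a face of `K`, then `L` is
polytopal exactly if `K` is. -/
theorem isPolytopalSphere_iff_of_copies {ι κ : Type*} {K : PreAbstractSimplicialComplex ι}
    {L : PreAbstractSimplicialComplex κ} (hK : (vertices K).Finite) (hL : (vertices L).Finite)
    {g : κ → ι} (hg : Set.MapsTo g (vertices L) (vertices K))
    (hg' : Set.SurjOn g (vertices L) (vertices K))
    (h : ∀ s : Finset κ, s.Nonempty → (s : Set κ) ⊆ vertices L → (s ∈ L.faces ↔
      ∃ t ∈ allFaces K, ∀ v, v ∈ t ↔ v ∈ vertices K ∧ ∀ w ∈ vertices L, g w = v → w ∈ s)) :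
    IsPolytopalSphere L ↔ IsPolytopalSphere K := by
  have := hL.to_subtype
  refine isPolytopalSphere_iff_of_fibreCore hK hL (hg.restrict_surjective_iff.2 hg') fun s hs => ?_
  have hfin : (Subtype.val '' s).Finite := s.toFinite.image _
  have h1 := h hfin.toFinset (by simpa using hs)
    (by rw [hfin.coe_toFinset]; exact Subtype.coe_image_subset _ _)
  have h2 : s ∈ vertexFaces L ↔ hfin.toFinset ∈ L.faces := by
    rw [mem_vertexFaces_iff hs]
    constructor
    · rintro ⟨F, hF, hsF⟩
      convert hF
      rw [← Finset.coe_inj, hfin.coe_toFinset, hsF]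
    · exact fun hF => ⟨_, hF, hfin.coe_toFinset.symm⟩
  rw [h2, h1]
  refine exists_congr fun t => and_congr_right fun _ => ?_
  rw [Set.ext_iff]
  refine forall_congr' fun v => ?_
  rw [Finset.mem_coe, @Iff.comm (v ∈ t)]
  refine iff_congr ?_ Iff.rfl
  constructor
  · rintro ⟨hv, hw⟩
    exact ⟨⟨v, hv⟩, fun w hwv => by simpa using hw w w.2 (congrArg Subtype.val hwv), rfl⟩
  · rintro ⟨v, hv, rfl⟩
    exact ⟨v.2, fun w hw hwv => by simpa using ⟨hw, hv ⟨w, hw⟩ (Subtype.ext hwv)⟩⟩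

/-! ### One-point suspensions -/

theorem inl_mem_vertices_onePointSuspension {ι : Type*} [DecidableEq ι] (v : ι)
    (S : PreAbstractSimplicialComplex ι) (b : Bool) :
    Sum.inl b ∈ vertices (onePointSuspension v S) := by
  refine ⟨Finset.singleton_nonempty _, mem_suspFaces.2 (Or.inl ⟨?_, ?_, ?_⟩)⟩
  · intro h
    have := Finset.mem_univ (!b)
    rw [← h, Finset.mem_toLeft] at this
    simp at this
  · have : ({Sum.inl b} : Finset (Bool ⊕ ι)).toRight = ∅ := by ext; simp
    rw [this]
    exact Or.inl rfl
  · simp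

theorem inr_mem_vertices_onePointSuspension {ι : Type*} [DecidableEq ι] {v x : ι}
    {S : PreAbstractSimplicialComplex ι} :
    Sum.inr x ∈ vertices (onePointSuspension v S) ↔ x ∈ vertices S ∧ x ≠ v := by
  have hR : ({Sum.inr x} : Finset (Bool ⊕ ι)).toRight = {x} := by ext; simp
  have hL : ({Sum.inr x} : Finset (Bool ⊕ ι)).toLeft = ∅ := by ext; simp
  have hx : {x} ∈ allFaces S ↔ x ∈ vertices S := by simp [allFaces, vertices]
  have : Sum.inr x ∈ vertices (onePointSuspension v S) ↔
      ({Sum.inr x} : Finset (Bool ⊕ ι)) ∈ suspFaces v S :=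
    ⟨fun h => h.2, fun h => ⟨Finset.singleton_nonempty _, h⟩⟩
  rw [this, mem_suspFaces, hR, hL, hx]
  simp only [link, Set.mem_ofPred_eq, hx, Finset.mem_singleton]
  have : (∅ : Finset Bool) ≠ Finset.univ := by decide
  constructor
  · rintro (⟨-, h1, h2⟩ | ⟨h1, h2, -⟩) <;> exact ⟨h1, fun h => h2 h.symm⟩
  · rintro ⟨h1, h2⟩
    exact Or.inl ⟨this, h1, fun h => h2 h.symm⟩

theorem isPolytopalSphere_onePointSuspension_iff {ι : Type*} [DecidableEq ι]
    {S : PreAbstractSimplicialComplex ι} (hS : S.faces.Finite) {v : ι} (hv : v ∈ vertices S) :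
    IsPolytopalSphere (onePointSuspension v S) ↔ IsPolytopalSphere S := by
  have hinl := inl_mem_vertices_onePointSuspension v S
  have hinr := fun x => inr_mem_vertices_onePointSuspension (v := v) (x := x) (S := S)
  refine isPolytopalSphere_iff_of_copies (g := Sum.elim (fun _ => v) id) (finite_vertices hS)
    ?_ ?_ ?_ ?_
  · refine ((Set.finite_range Sum.inl).union ((finite_vertices hS).image Sum.inr)).subset ?_
    rintro (b | x) h
    · exact Or.inl ⟨b, rfl⟩
    · exact Or.inr ⟨x, ((hinr x).1 h).1, rfl⟩
  · rintro (b | x) h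
    · exact hv
    · exact ((hinr x).1 h).1
  · intro x hx
    by_cases hxv : x = v
    · exact ⟨Sum.inl false, hinl false, hxv.symm⟩
    · exact ⟨Sum.inr x, (hinr x).2 ⟨hx, hxv⟩, rfl⟩
  intro s hs hsV
  have hvR : v ∉ s.toRight := fun h => ((hinr v).1 (hsV (Finset.mem_toRight.1 h))).2 rfl
  -- The copies of `v` are `v'` and `v''`, and every other vertex is its own only copy. So `v` joins
  -- the fibre core only when both new vertices are present.
  have hcore : ∀ x, (x ∈ vertices S ∧ ∀ w ∈ vertices (onePointSuspension v S),
      Sum.elim (fun _ => v) id w = x → w ∈ s) ↔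
        x ∈ if s.toLeft = Finset.univ then insert v s.toRight else s.toRight := by
    intro x
    by_cases hxv : x = v
    · subst hxv
      have : (∀ b, Sum.inl b ∈ s) ↔ s.toLeft = Finset.univ := by
        simp only [Finset.eq_univ_iff_forall, Finset.mem_toLeft]
      split_ifs with h
      · simp only [Finset.mem_insert_self, iff_true]
        refine ⟨hv, ?_⟩
        rintro (b | y) hw hwx
        · exact this.2 h b
        · exact absurd hwx ((hinr y).1 hw).2
      · simp only [hvR, iff_false]
        exact fun h' => h (this.1 fun b => h'.2 _ (hinl b) rfl)
    · have : (x ∈ if s.toLeft = Finset.univ then insert v s.toRight else s.toRight) ↔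
          Sum.inr x ∈ s := by
        split_ifs <;> simp [hxv]
      rw [this]
      constructor
      · exact fun h => h.2 _ ((hinr x).2 ⟨h.1, hxv⟩) rfl
      · intro h
        refine ⟨((hinr x).1 (hsV h)).1, ?_⟩
        rintro (b | y) hw hwx
        · exact absurd hwx.symm hxv
        · exact (show y = x from hwx) ▸ h
  have hface : s ∈ (onePointSuspension v S).faces ↔
      (if s.toLeft = Finset.univ then insert v s.toRight else s.toRight) ∈ allFaces S := by
    refine Iff.trans ⟨fun h => h.2, fun h => ⟨hs, h⟩⟩ (mem_suspFaces.trans ?_)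
    split_ifs with h
    · exact ⟨fun h' => h'.elim (fun h' => absurd h h'.1) fun h' => h'.2.2,
        fun h' => Or.inr ⟨allFaces_mono h' (Finset.subset_insert _ _), hvR, h'⟩⟩
    · exact ⟨fun h' => h'.elim (fun h' => h'.2.1) fun h' => h'.1, fun h' => Or.inl ⟨h, h', hvR⟩⟩
  rw [hface]
  constructor
  · exact fun h => ⟨_, h, fun x => (hcore x).symm⟩
  · rintro ⟨t, ht, htx⟩
    convert ht
    ext x
    rw [htx, hcore]

/-! ### Wreath products -/

theorem exists_maximal_face {ι : Type*} {S : PreAbstractSimplicialComplex ι}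
    (hS : S.faces.Finite) (hne : S.faces.Nonempty) {t : Finset ι} (ht : t ∈ allFaces S) :
    ∃ F, Maximal (· ∈ S.faces) F ∧ t ⊆ F := by
  have key : ∀ t ∈ S.faces, ∃ F, Maximal (· ∈ S.faces) F ∧ t ⊆ F := fun t ht => by
    obtain ⟨F, htF, hF⟩ := hS.exists_le_maximal ht
    exact ⟨F, hF, htF⟩
  rcases ht with rfl | ht
  · obtain ⟨F, hF, -⟩ := key _ hne.some_mem
    exact ⟨F, hF, Finset.empty_subset F⟩
  · exact key t ht

theorem mem_wreathProduct_faces_iff {ι : Type*} {S : PreAbstractSimplicialComplex ι}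
    (hS : S.faces.Finite) {d : ℕ} {s : Finset (ι × Fin (d + 1))} (hs : s.Nonempty) :
    s ∈ (wreathProduct d S).faces ↔ (∀ w ∈ s, w.1 ∈ vertices S) ∧
      ∃ t ∈ allFaces S, ∀ v, v ∈ t ↔ v ∈ vertices S ∧ ∀ i, (v, i) ∈ s := by
  classical
  constructor
  · rintro ⟨-, T, ⟨F, hF, c, hT⟩, hsT⟩
    have hV : ∀ w ∈ s, w.1 ∈ vertices S := fun w hw => ((hT w.1 w.2).1 (hsT hw)).1
    -- A vertex with all its copies in `s` lies in `F`, since outside `F` the copy `c v` is missing.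
    refine ⟨hV, F.filter fun v => v ∈ vertices S ∧ ∀ i, (v, i) ∈ s,
      allFaces_mono (Or.inr hF.1) (Finset.filter_subset _ _), fun v => ?_⟩
    rw [Finset.mem_filter, and_iff_right_iff_imp]
    rintro ⟨-, hi⟩
    exact ((hT v (c v)).1 (hsT (hi _))).2.resolve_right fun h => h rfl
  · rintro ⟨hV, t, ht, htv⟩
    obtain ⟨F, hF, htF⟩ := exists_maximal_face hS ⟨_, hV _ hs.choose_spec⟩ ht
    -- A vertex outside `F` is not in `t`, so `s` misses one of its copies, and that copy can be the
    -- omitted one. For all other points the choice is arbitrary.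
    have hc : ∀ v, ∃ i, v ∈ vertices S → v ∉ F → (v, i) ∉ s := by
      intro v
      by_contra! h
      exact (h 0).2.1 (htF ((htv v).2 ⟨(h 0).1, fun i => (h i).2.2⟩))
    choose c hc using hc
    have hfin : {w : ι × Fin (d + 1) | w.1 ∈ vertices S ∧ (w.1 ∈ F ∨ w.2 ≠ c w.1)}.Finite :=
      ((finite_vertices hS).prod Set.finite_univ).subset fun w hw => ⟨hw.1, trivial⟩
    refine ⟨hs, hfin.toFinset, ⟨F, hF, c, fun v i => by simp⟩, fun w hw => ?_⟩
    rw [hfin.mem_toFinset]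
    refine ⟨hV w hw, or_iff_not_imp_left.2 fun hwF hwc => hc w.1 (hV w hw) hwF ?_⟩
    rwa [← hwc]

theorem mem_vertices_wreathProduct {ι : Type*} {S : PreAbstractSimplicialComplex ι}
    (hS : S.faces.Finite) {d : ℕ} {w : ι × Fin (d + 1)} :
    w ∈ vertices (wreathProduct d S) ↔ w.1 ∈ vertices S := by
  classical
  refine (mem_wreathProduct_faces_iff hS (Finset.singleton_nonempty w)).trans
    ⟨fun h => h.1 w (Finset.mem_singleton_self w), fun h => ⟨by simpa using h, ?_⟩⟩
  refine ⟨({w.1} : Finset ι).filter fun v => ∀ i, (v, i) ∈ ({w} : Finset _),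
    allFaces_mono (Or.inr h) (Finset.filter_subset _ _), fun v => ?_⟩
  rw [Finset.mem_filter, Finset.mem_singleton]
  refine and_congr_left fun hv => ⟨fun h' => h' ▸ h, fun _ => ?_⟩
  exact congrArg Prod.fst (Finset.mem_singleton.1 (hv 0))

theorem isPolytopalSphere_wreathProduct_iff {ι : Type*} {S : PreAbstractSimplicialComplex ι}
    (hS : S.faces.Finite) (d : ℕ) :
    IsPolytopalSphere (wreathProduct d S) ↔ IsPolytopalSphere S := by
  have hvert := fun w => mem_vertices_wreathProduct hS (d := d) (w := w)
  refine isPolytopalSphere_iff_of_copies (g := Prod.fst) (finite_vertices hS) ?_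
    (fun w hw => (hvert w).1 hw) (fun v hv => ⟨(v, 0), (hvert _).2 hv, rfl⟩) fun s hs hsV => ?_
  · exact ((finite_vertices hS).prod Set.finite_univ).subset fun w hw => ⟨(hvert w).1 hw, trivial⟩
  · rw [mem_wreathProduct_faces_iff hS hs, and_iff_right (fun w hw => (hvert w).1 (hsV (Finset.mem_coe.2 hw)))]
    refine exists_congr fun t => and_congr_right fun _ => forall_congr' fun v => ?_
    refine iff_congr Iff.rfl (and_congr_right fun hv => ⟨?_, fun h i => h _ ((hvert _).2 hv) rfl⟩)
    rintro h ⟨_, i⟩ - rfl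
    exact h i

end PolytopalSpheres

theorem mainTheorem8 {ι : Type*} [DecidableEq ι] (S : PreAbstractSimplicialComplex ι)
    (hS : S.faces.Finite) :
    (∀ v ∈ PolytopalSpheres.vertices S,
      (PolytopalSpheres.IsPolytopalSphere (PolytopalSpheres.onePointSuspension v S) ↔
        PolytopalSpheres.IsPolytopalSphere S)) ∧
    ∀ d : ℕ,
      (PolytopalSpheres.IsPolytopalSphere (PolytopalSpheres.wreathProduct d S) ↔
        PolytopalSpheres.IsPolytopalSphere S) := by
  exact ⟨fun _ hv => PolytopalSpheres.isPolytopalSphere_onePointSuspension_iff hS hv,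
    PolytopalSpheres.isPolytopalSphere_wreathProduct_iff hS⟩
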